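/- All graphs are finite and simple; write $|G|$ for the number of vertices and $e(G)$ for the number of edges of $G$. A graph is $F$-hom-free if it admits no homomorphism from $F$, and $F$-free if it does not contain $F$ as a (not necessarily induced) subgraph. Two graphs on the same vertex set of size $n$ are $\varepsilon$-close if their edge sets differ in at most $\varepsilon n^2$ pairs, and $G$ is $\varepsilon$-far from a graph property if it is not $\varepsilon$-close to any graph on $V(G)$ with that property. A map $V(G)\to V(\Gamma)$ is an $\varepsilon$-approximate homomorphism if it maps all but at most $\varepsilon |G|^2$ edges of $G$ to edges of $\Gamma$. For graphs $F,H$ such that there is a homomorphism $H\to F$, and for $\varepsilon>0$, let $M_{F,H}(\varepsilon)$ be the smallest $M$ such that every $H$-hom-free graph has an $\varepsilon$-approximate homomorphism to some $F$-hom-free graph on at most $M$ vertices. Copies of $H$ in $G$ are counted with labels, i.e. as injective homomorphisms $H\to G$ (hypotheses about unlabelled copies are stronger). **Proposition.** Let $F,H$ be graphs such that there is a homomorphism $H\to F$, and let $\delta:(0,1)\to(0,1)$ be a function such that for every $\varepsilon\in(0,1)$, every sufficiently large graph $G$ (i.e. $|G|\ge n_0$, where $n_0$ may depend on $\varepsilon$)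 that is $\varepsilon$-far from being $F$-hom-free contains at least $\delta(\varepsilon)\,|G|^{|H|}$ copies of $H$. Then for every $\varepsilon\in(0,2)$ (the range in which $\delta(\varepsilon/2)$ is defined) the number $M_{F,H}(\varepsilon)$ exists and $$M_{F,H}(\varepsilon)\le 2^{K^2},\qquad K=\frac{5\,e(H)\,(2/\varepsilon)^{e(H)}}{\delta(\varepsilon/2)} .$$ Consequently, let $k\ge 0$ be an integer, let $H$ be a graph that admits a homomorphism to $K_k$, and suppose that $H$ is $K_k$-abundant, that is, there are constants $c,C>0$ such that for every $\varepsilon\in(0,1)$ every sufficiently large graph $G$ (in terms of $\varepsilon$) that is $\varepsilon$-far from $K_k$-free contains at least $c\,\varepsilon^{C}|G|^{|H|}$ copies of $H$. Then there are constants $c',C'>0$ such that for every $\varepsilon>0$ the number $M_{K_k,H}(\varepsilon)$ exists and $$M_{K_k,H}(\varepsilon)\le 2^{c'(1/\varepsilon)^{C'}} .$$ -/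

import Mathlib

/-! All graphs are finite and simple. -/

namespace AsymApproxHom

/-- `G` is `F`-hom-free: there is no homomorphism from `F` to `G`. -/
def HomFree {U V : Type*} (F : SimpleGraph U) (G : SimpleGraph V) : Prop :=
  IsEmpty (F →g G)

/-- Two graphs on the same vertex set `V` are `ε`-close if one is obtained from the other by
adding/deleting at most `ε |V|²` edges. -/
def IsClose {V : Type*} [Fintype V] (ε : ℝ) (G G' : SimpleGraph V) : Prop :=
  ((symmDiff G.edgeSet G'.edgeSet).ncard : ℝ) ≤ ε * (Fintype.card V : ℝ) ^ 2

/-- `G` is `ε`-far from the graph property `P` if it is not `ε`-close to any graph (on the same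
vertex set) satisfying `P`. -/
def IsFarFrom {V : Type*} [Fintype V] (ε : ℝ) (P : SimpleGraph V → Prop) (G : SimpleGraph V) :
    Prop :=
  ∀ G' : SimpleGraph V, P G' → ¬ IsClose ε G G'

/-- A map `φ : V(G) → V(Γ)` is an `ε`-approximate homomorphism if all but at most `ε |V(G)|²` edges
of `G` are mapped to edges of `Γ`. -/
def IsApproxHom {V W : Type*} [Fintype V] (ε : ℝ) (G : SimpleGraph V) (Γ : SimpleGraph W)
    (φ : V → W) : Prop :=
  ({e ∈ G.edgeSet | Sym2.map φ e ∉ Γ.edgeSet}.ncard : ℝ) ≤ ε * (Fintype.card V : ℝ) ^ 2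

/-- The set of all `M` such that every `H`-hom-free graph has an `ε`-approximate homomorphism to an
`F`-hom-free graph on at most `M` vertices. -/
def approxHomBounds {U W : Type*} (F : SimpleGraph U) (H : SimpleGraph W) (ε : ℝ) : Set ℕ :=
  {M | ∀ (V : Type) [Fintype V] (G : SimpleGraph V), HomFree H G →
    ∃ (X : Type) (_ : Fintype X) (Γ : SimpleGraph X) (φ : V → X),
      Fintype.card X ≤ M ∧ HomFree F Γ ∧ IsApproxHom ε G Γ φ}

/-- `M_{F,H}(ε)`: the least element of `approxHomBounds F H ε` (meaningful when that set is
non-empty). -/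
noncomputable def approxHomNumber {U W : Type*} (F : SimpleGraph U) (H : SimpleGraph W) (ε : ℝ) :
    ℕ :=
  sInf (approxHomBounds F H ε)

/-- Every sufficiently large graph `G` that is `ε`-far from satisfying `P` contains at least
`d |G|^|H|` (labelled) copies of `H`.

"Sufficiently large" (depending on `ε`) cannot be dropped without emptying the notion: `K₃` is
`ε`-far from triangle-free for every `ε < 1/9`, but contains no copy of `C₅`. Labelled copies are at
least as many as unlabelled ones. -/
def FarImpliesManyCopies {W : Type*} [Fintype W]
    (P : ∀ {V : Type}, SimpleGraph V → Prop) (H : SimpleGraph W) (ε d : ℝ) : Prop :=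
  ∃ n₀ : ℕ, ∀ (V : Type) [Fintype V] (G : SimpleGraph V), n₀ ≤ Fintype.card V →
    IsFarFrom ε P G →
      d * (Fintype.card V : ℝ) ^ Fintype.card W ≤ (G.labelledCopyCount H : ℝ)

/-- `H` is `F`-abundant: graphs that are `ε`-far from `F`-free (i.e. from not containing `F` as a
subgraph) contain at least `poly(ε) |G|^|H|` copies of `H`, where `poly(ε)` is of the form
`c ε ^ C` with constants `c, C > 0`. -/
def IsAbundant {U W : Type*} [Fintype W] (F : SimpleGraph U) (H : SimpleGraph W) : Prop :=
  ∃ c C : ℝ, 0 < c ∧ 0 < C ∧ ∀ ε ∈ Set.Ioo (0 : ℝ) 1,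
    FarImpliesManyCopies (fun G => F.Free G) H ε (c * ε ^ C)

end AsymApproxHom

/-!
A hom-free graph is approximated through weak (Frieze–Kannan) regularity, which costs only
exponentially many parts in the square of the inverse error and still controls the number of
homomorphisms from a fixed graph.

Let `G` be a nonempty `H`-hom-free graph on `V`, and let `w` be its density kernel with respect to a
weakly regular partition (`exists_weak_regular_graph`). By the counting lemma
(`abs_sum_prod_sub_le`) the `w`-weighted number of homomorphisms from `H` is small, because `G` has
no homomorphism from `H` at all. Consider the graph of the dense pairs, those with `w ≥ ε / 2`,
blown up so much that the removal hypothesis applies to it (`denseGraph`). Were it `ε / 2`-far from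
being `F`-hom-free, it would contain many copies of `H`, each of which contributes at least
`(ε / 2) ^ e(H)` to the weighted count (`pow_mul_labelledCopyCount_le`), a contradiction. So it is
`ε / 2`-close to some `F`-hom-free graph `Γ'`. Choosing a random representative of each part, `Γ'`
induces an `F`-hom-free graph on the representatives, and mapping each vertex to its part loses in
expectation only the edges in sparse pairs, the edges inside parts, and the pairs in which `Γ'`
differs from the dense graph (`exists_approxHom_of_dense_close`). Edges inside parts are made rare
by first splitting every part by a random colouring.

Working with a blow-up of the dense graph, instead of the dense graph on `V` itself, is what lets
the argument cover small graphs `G`, although the removal hypothesis concerns large graphs only.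

For complete graphs, hom-freeness and freeness coincide because homomorphisms from a complete graph
are injective, so abundance supplies a power function as `δ`. For `ε ≥ 2` the general bound is
unavailable and a single vertex suffices (`approxHomNumber_le_one`).
-/

namespace AsymApproxHom

open Finset

/-! ### Averaging over product spaces -/

/-- Resampling one coordinate of a uniformly random point of a product does not change its
distribution. -/
theorem sum_sum_update {ι : Type*} [Fintype ι] [DecidableEq ι] {A : ι → Type*}
    [∀ i, Fintype (A i)] (i : ι) (f : (∀ i, A i) → ℝ) :
    ∑ x, ∑ a : A i, f (Function.update x i a) = Fintype.card (A i) * ∑ x, f x := by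
  have hinv : Function.Involutive
      (fun z : (∀ i, A i) × A i => (Function.update z.1 i z.2, z.1 i)) := by
    rintro ⟨x, a⟩
    simp
  rw [← Fintype.sum_prod_type' (f := fun x (a : A i) => f (Function.update x i a)),
    Fintype.sum_bijective _ hinv.bijective _ (fun z : (∀ i, A i) × A i => f z.1) fun _ => rfl,
    Fintype.sum_prod_type]
  simp [Finset.mul_sum]

theorem sum_sum_sum_update {ι : Type*} [Fintype ι] [DecidableEq ι] {A : ι → Type*}
    [∀ i, Fintype (A i)] (i j : ι) (f : (∀ i, A i) → ℝ) :
    ∑ x, ∑ a : A i, ∑ b : A j, f (Function.update (Function.update x i a) j b) =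
      Fintype.card (A i) * (Fintype.card (A j) * ∑ x, f x) := by
  rw [sum_sum_update i (fun x => ∑ b : A j, f (Function.update x j b)), sum_sum_update]

/-- Two different coordinates of a uniformly random point of a product are independent and
uniform. -/
theorem card_mul_card_mul_sum_pair {ι : Type*} [Fintype ι] [DecidableEq ι] {A : ι → Type*}
    [∀ i, Fintype (A i)] {i j : ι} (hij : i ≠ j) (f : A i → A j → ℝ) :
    Fintype.card (A i) * (Fintype.card (A j) * ∑ x : ∀ i, A i, f (x i) (x j)) =
      Fintype.card (∀ i, A i) * ∑ a, ∑ b, f a b := by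
  rw [← sum_sum_sum_update i j (fun x => f (x i) (x j))]
  simp [Function.update_of_ne hij]

/-- A random colouring with `k` colours is monochromatic on at most a `1/k` proportion of the
pairs. -/
theorem exists_coloring {V : Type*} [Fintype V] [DecidableEq V] {k : ℕ} (hk : 0 < k) :
    ∃ c : V → Fin k, ∑ u, ∑ v, (if u ≠ v ∧ c u = c v then (1 : ℝ) else 0) ≤
      (Fintype.card V : ℝ) ^ 2 / k := by
  have : Nonempty (Fin k) := ⟨⟨0, hk⟩⟩
  have hk' : (0 : ℝ) < k := by exact_mod_cast hk
  have hpair : ∀ u v : V, ∑ c : V → Fin k, (if u ≠ v ∧ c u = c v then (1 : ℝ) else 0) ≤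
      Fintype.card (V → Fin k) / k := by
    intro u v
    by_cases h : u = v
    · simp only [h, ne_eq, not_true_eq_false, false_and, if_false, sum_const_zero]
      positivity
    · have := card_mul_card_mul_sum_pair (A := fun _ => Fin k) h
        (fun a b => if a = b then (1 : ℝ) else 0)
      simp only [Fintype.card_fin, sum_ite_eq, mem_univ, if_true, sum_const, card_univ,
        nsmul_eq_mul, mul_one] at this
      simp only [h, ne_eq, not_false_eq_true, true_and]
      rw [le_div_iff₀ hk']
      refine le_of_mul_le_mul_left (a := (k : ℝ)) ?_ hk'
      linarith
  have hex : ∃ c ∈ (univ : Finset (V → Fin k)),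
      ∑ u, ∑ v, (if u ≠ v ∧ c u = c v then (1 : ℝ) else 0) ≤
        (Fintype.card V : ℝ) ^ 2 / k := by
    refine exists_le_of_sum_le univ_nonempty ?_
    rw [sum_comm]
    calc ∑ u, ∑ c : V → Fin k, ∑ v, (if u ≠ v ∧ c u = c v then (1 : ℝ) else 0)
        ≤ ∑ _u : V, ∑ _v : V, (Fintype.card (V → Fin k) / k : ℝ) := by
          refine sum_le_sum fun u _ => ?_
          rw [sum_comm]
          exact sum_le_sum fun v _ => hpair u v
      _ = ∑ _c : V → Fin k, (Fintype.card V : ℝ) ^ 2 / k := by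
          simp only [sum_const, card_univ, nsmul_eq_mul]
          ring
  obtain ⟨c, -, hc⟩ := hex
  exact ⟨c, hc⟩

/-- Choosing a uniformly random representative of every block of a partition, and replacing every
point by the representative of its block, preserves the expected weight of the pairs that lie in
different blocks. -/
theorem exists_representatives {Y X : Type*} [Fintype Y] [Fintype X] [DecidableEq X]
    {π : Y → X} (hπ : Function.Surjective π) (B : Y → Y → ℝ) :
    ∃ r : X → Y, (∀ i, π (r i) = i) ∧
      ∑ x, ∑ y, (if π x ≠ π y then B (r (π x)) (r (π y)) else 0) ≤
        ∑ x, ∑ y, (if π x ≠ π y then B x y else 0) := by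
  classical
  have hne : Nonempty (∀ i, {y // π y = i}) := ⟨fun i => ⟨_, (hπ i).choose_spec⟩⟩
  have fib : ∀ f : Y → ℝ, ∑ y, f y = ∑ i, ∑ a : {y // π y = i}, f a := fun f =>
    (Fintype.sum_fiberwise π f).symm
  -- Both sides are sums over pairs of different blocks.
  have hL : ∀ r : X → Y, ∑ x, ∑ y, (if π x ≠ π y then B (r (π x)) (r (π y)) else 0) =
      ∑ i, ∑ j, (if i ≠ j then (Fintype.card {y // π y = i} : ℝ) *
        (Fintype.card {y // π y = j} * B (r i) (r j)) else 0) := by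
    intro r
    rw [fib]
    refine sum_congr rfl fun i _ => ?_
    have : ∀ a : {y // π y = i},
        ∑ y, (if π a ≠ π y then B (r (π a)) (r (π y)) else 0) =
        ∑ j, (if i ≠ j then (Fintype.card {y // π y = j} * B (r i) (r j)) else 0) := by
      rintro ⟨a, rfl⟩
      rw [fib]
      refine sum_congr rfl fun j _ => ?_
      rw [sum_congr rfl (g := fun _ => if π a ≠ j then B (r (π a)) (r j) else 0)
        (by rintro ⟨b, rfl⟩ _; rfl)]
      simp
    rw [sum_congr rfl fun a _ => this a]
    simp [mul_sum]
  have hR : ∑ x, ∑ y, (if π x ≠ π y then B x y else 0) =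
      ∑ i, ∑ j, (if i ≠ j then ∑ a : {y // π y = i}, ∑ b : {y // π y = j}, B a b else 0) := by
    rw [fib]
    refine sum_congr rfl fun i _ => ?_
    have : ∀ a : {y // π y = i}, ∑ y, (if π a ≠ π y then B a y else 0) =
        ∑ j, (if i ≠ j then ∑ b : {y // π y = j}, B a b else 0) := by
      rintro ⟨a, rfl⟩
      rw [fib]
      refine sum_congr rfl fun j _ => ?_
      rw [sum_congr rfl (g := fun b : {y // π y = j} => if π a ≠ j then B a b else 0)
        (by rintro ⟨b, rfl⟩ _; rfl)]
      split_ifs <;> simp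
    rw [sum_congr rfl fun a _ => this a, sum_comm]
    refine sum_congr rfl fun j _ => ?_
    split_ifs <;> simp
  have hex : ∃ r ∈ (univ : Finset (∀ i, {y // π y = i})),
      ∑ x, ∑ y, (if π x ≠ π y then B (r (π x)) (r (π y)) else 0) ≤
        ∑ x, ∑ y, (if π x ≠ π y then B x y else 0) := by
    refine exists_le_of_sum_le univ_nonempty (le_of_eq ?_)
    rw [sum_congr rfl fun r _ => hL fun i => r i, sum_const, hR, nsmul_eq_mul, mul_sum, sum_comm]
    refine sum_congr rfl fun i _ => ?_
    rw [sum_comm, mul_sum]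
    refine sum_congr rfl fun j _ => ?_
    by_cases h : i = j
    · simp [h]
    · simp only [ne_eq, h, not_false_eq_true, if_true]
      rw [← mul_sum, ← mul_sum]
      exact card_mul_card_mul_sum_pair (A := fun i => {y // π y = i}) h (fun a b => B a b)
  obtain ⟨r, -, hr⟩ := hex
  exact ⟨fun i => r i, fun i => (r i).2, hr⟩

/-! ### Weak regularity -/

/-- The average of `f` over the points that `π` does not distinguish from `x`: the conditional
expectation of `f` with respect to the partition into the fibres of `π`. -/
noncomputable def condAvg {α β : Type*} [Fintype α] [DecidableEq β] (π : α → β) (f : α → ℝ)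
    (x : α) : ℝ :=
  (∑ y with π y = π x, f y) / #{y | π y = π x}

section condAvg

variable {α β γ : Type*} [Fintype α] [DecidableEq β] [DecidableEq γ]

theorem condAvg_congr (π : α → β) (f : α → ℝ) {x y : α} (h : π x = π y) :
    condAvg π f x = condAvg π f y := by
  simp only [condAvg, h]

theorem condAvg_nonneg (π : α → β) {f : α → ℝ} (hf : ∀ x, 0 ≤ f x) (x : α) :
    0 ≤ condAvg π f x :=
  div_nonneg (sum_nonneg fun y _ => hf y) (Nat.cast_nonneg _)

theorem condAvg_le_one (π : α → β) {f : α → ℝ} (hf : ∀ x, f x ≤ 1) (x : α) :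
    condAvg π f x ≤ 1 := by
  refine div_le_one_of_le₀ ?_ (Nat.cast_nonneg _)
  refine (sum_le_sum fun y _ => hf y).trans ?_
  simp

/-- Conditional expectation is self-adjoint: it may be dropped when integrated against a function
that is constant on the fibres. -/
theorem sum_condAvg_mul (π : α → β) (f h : α → ℝ) (hh : ∀ x y, π x = π y → h x = h y) :
    ∑ x, condAvg π f x * h x = ∑ x, f x * h x := by
  have hc : ∀ y : α, (#{x | π x = π y} : ℝ) ≠ 0 := fun y => by
    have : 0 < #{x | π x = π y} := card_pos.mpr ⟨y, by simp⟩
    positivity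
  calc ∑ x, condAvg π f x * h x
      = ∑ x, ∑ y, (if π y = π x then f y * (h y / #{z | π z = π y}) else 0) := by
        refine sum_congr rfl fun x _ => ?_
        rw [condAvg, div_mul_eq_mul_div, sum_mul, sum_div, sum_filter]
        refine sum_congr rfl fun y _ => ?_
        split_ifs with hxy
        · rw [hh y x hxy, hxy, mul_div_assoc]
        · rfl
    _ = ∑ y, ∑ x, (if π x = π y then f y * (h y / #{z | π z = π y}) else 0) := by
        rw [sum_comm]
        simp only [eq_comm]
    _ = ∑ y, f y * h y := by
        refine sum_congr rfl fun y _ => ?_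
        rw [← sum_filter, sum_const, nsmul_eq_mul]
        field_simp [hc y]

theorem sum_mul_condAvg (π : α → β) (f : α → ℝ) :
    ∑ x, f x * condAvg π f x = ∑ x, condAvg π f x ^ 2 := by
  rw [← sum_condAvg_mul π f (condAvg π f) fun x y => condAvg_congr π f]
  simp only [sq]

theorem sum_condAvg_sq_le (π : α → β) (f : α → ℝ) :
    ∑ x, condAvg π f x ^ 2 ≤ ∑ x, f x ^ 2 := by
  have h : 0 ≤ ∑ x, (f x - condAvg π f x) ^ 2 := sum_nonneg fun x _ => sq_nonneg _
  have e : ∑ x, (f x - condAvg π f x) ^ 2 =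
      ∑ x, f x ^ 2 - 2 * ∑ x, f x * condAvg π f x + ∑ x, condAvg π f x ^ 2 := by
    rw [mul_sum, ← sum_sub_distrib, ← sum_add_distrib]
    exact sum_congr rfl fun x _ => by ring
  rw [e, sum_mul_condAvg] at h
  linarith

/-- Energy increment: if `f - condAvg π f` correlates with a bounded function `h`, then any
refinement of `π` that makes `h` measurable has larger energy. -/
theorem sq_sum_sub_condAvg_mul_le (π : α → β) (π' : α → γ)
    (hππ' : ∀ x y, π' x = π' y → π x = π y) (f h : α → ℝ)
    (hh : ∀ x y, π' x = π' y → h x = h y) (hh1 : ∀ x, h x ^ 2 ≤ 1) :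
    (∑ x, (f x - condAvg π f x) * h x) ^ 2 ≤
      Fintype.card α * (∑ x, condAvg π' f x ^ 2 - ∑ x, condAvg π f x ^ 2) := by
  have hcross : ∑ x, condAvg π' f x * condAvg π f x = ∑ x, condAvg π f x ^ 2 := by
    rw [sum_condAvg_mul π' f _ fun x y hxy => condAvg_congr π f (hππ' x y hxy), sum_mul_condAvg]
  have e1 : ∑ x, (f x - condAvg π f x) * h x =
      ∑ x, (condAvg π' f x - condAvg π f x) * h x := by
    simp only [sub_mul, sum_sub_distrib]
    rw [sum_condAvg_mul π' f h hh]
  have e2 : ∑ x, (condAvg π' f x - condAvg π f x) ^ 2 =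
      ∑ x, condAvg π' f x ^ 2 - ∑ x, condAvg π f x ^ 2 := by
    have : ∑ x, (condAvg π' f x - condAvg π f x) ^ 2 =
        ∑ x, condAvg π' f x ^ 2 - 2 * ∑ x, condAvg π' f x * condAvg π f x +
          ∑ x, condAvg π f x ^ 2 := by
      rw [mul_sum, ← sum_sub_distrib, ← sum_add_distrib]
      exact sum_congr rfl fun x _ => by ring
    rw [this, hcross]
    ring
  have h2 : ∑ x, h x ^ 2 ≤ Fintype.card α := by
    refine (sum_le_sum fun x _ => hh1 x).trans ?_
    simp
  rw [e1]
  refine (sum_mul_sq_le_sq_mul_sq _ _ _).trans ?_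
  rw [← e2, mul_comm]
  exact mul_le_mul_of_nonneg_right h2 (sum_nonneg fun x _ => sq_nonneg _)

end condAvg

/-- The Frieze–Kannan weak regularity lemma. The parts are labelled by `Fin s → Bool × Bool`,
because each of the `s` energy increments splits every part into at most four. -/
theorem exists_weak_regular {V : Type*} [Fintype V] [Nonempty V] (g : V × V → ℝ)
    (hg0 : ∀ x, 0 ≤ g x) (hg1 : ∀ x, g x ≤ 1) {η : ℝ} (hη : 0 < η) :
    ∃ s : ℕ, s * η ^ 2 ≤ 1 ∧ ∃ p : V → (Fin s → Bool × Bool), ∀ S T : Finset V,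
      |∑ u ∈ S, ∑ v ∈ T, (g (u, v) - condAvg (Prod.map p p) g (u, v))| ≤
        η * (Fintype.card V : ℝ) ^ 2 := by
  classical
  by_contra! hcon
  have hn : (0 : ℝ) < (Fintype.card V : ℝ) ^ 2 := by
    have : 0 < Fintype.card V := Fintype.card_pos
    positivity
  have hcard : ((Fintype.card (V × V) : ℕ) : ℝ) = (Fintype.card V : ℝ) ^ 2 := by
    rw [Fintype.card_prod]; push_cast; ring
  have bound : ∀ s : ℕ, ∀ p : V → (Fin s → Bool × Bool),
      ∑ x, condAvg (Prod.map p p) g x ^ 2 ≤ (Fintype.card V : ℝ) ^ 2 := by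
    intro s p
    refine (sum_condAvg_sq_le _ _).trans ?_
    refine (sum_le_sum fun x _ => pow_le_one₀ (hg0 x) (hg1 x)).trans ?_
    simp [← hcard]
  have key : ∀ s : ℕ, ∃ p : V → (Fin s → Bool × Bool),
      s * η ^ 2 * (Fintype.card V : ℝ) ^ 2 ≤ ∑ x, condAvg (Prod.map p p) g x ^ 2 := by
    intro s
    induction s with
    | zero => exact ⟨fun _ => Fin.elim0, by simpa using sum_nonneg fun x _ => sq_nonneg _⟩
    | succ s ih =>
      obtain ⟨p, hp⟩ := ih
      have hs : s * η ^ 2 ≤ 1 :=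
        le_of_mul_le_mul_right ((hp.trans (bound s p)).trans_eq (one_mul _).symm) hn
      obtain ⟨S, T, hST⟩ := hcon s hs p
      let q : V → (Fin (s + 1) → Bool × Bool) := fun u =>
        Fin.cons (decide (u ∈ S), decide (u ∈ T)) (p u)
      have hq : ∀ u v, q u = q v → p u = p v ∧ (u ∈ S ↔ v ∈ S) ∧ (u ∈ T ↔ v ∈ T) := by
        intro u v huv
        obtain ⟨h1, h2⟩ := Fin.cons_inj.mp huv
        simp only [Prod.mk.injEq, decide_eq_decide] at h1
        exact ⟨h2, h1⟩
      have hinc := sq_sum_sub_condAvg_mul_le (Prod.map p p) (Prod.map q q)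
        (fun x y hxy => by
          simp only [Prod.map, Prod.mk.injEq] at hxy ⊢
          exact ⟨(hq _ _ hxy.1).1, (hq _ _ hxy.2).1⟩) g
        (fun x => if x.1 ∈ S ∧ x.2 ∈ T then 1 else 0)
        (fun x y hxy => by
          simp only [Prod.map, Prod.mk.injEq] at hxy
          simp only [(hq _ _ hxy.1).2.1, (hq _ _ hxy.2).2.2])
        (fun x => by split_ifs <;> norm_num)
      have e : ∑ x : V × V, (g x - condAvg (Prod.map p p) g x) *
          (if x.1 ∈ S ∧ x.2 ∈ T then (1 : ℝ) else 0) =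
          ∑ u ∈ S, ∑ v ∈ T, (g (u, v) - condAvg (Prod.map p p) g (u, v)) := by
        rw [← sum_product', ← sum_filter_add_sum_filter_not univ (· ∈ S ×ˢ T)]
        rw [sum_congr rfl (s₁ := univ.filter (· ∉ S ×ˢ T)) (g := fun _ => (0 : ℝ)),
          sum_const_zero, add_zero]
        · refine sum_congr (by ext; simp) fun x hx => ?_
          simp [mem_product.mp hx]
        · intro x hx
          simp only [mem_filter, mem_univ, mem_product, true_and] at hx
          simp [hx]
      rw [e, hcard] at hinc
      refine ⟨q, ?_⟩
      have hsq : (η * (Fintype.card V : ℝ) ^ 2) ^ 2 ≤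
          (∑ u ∈ S, ∑ v ∈ T, (g (u, v) - condAvg (Prod.map p p) g (u, v))) ^ 2 := by
        rw [← sq_abs (∑ u ∈ S, _)]
        exact pow_le_pow_left₀ (by positivity) hST.le 2
      have hdiff : η ^ 2 * (Fintype.card V : ℝ) ^ 2 ≤
          ∑ x, condAvg (Prod.map q q) g x ^ 2 - ∑ x, condAvg (Prod.map p p) g x ^ 2 := by
        refine le_of_mul_le_mul_left ?_ hn
        linarith
      push_cast
      linarith
  obtain ⟨s, hs⟩ := exists_nat_gt (1 / η ^ 2)
  obtain ⟨p, hp⟩ := key s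
  have h1 : s * η ^ 2 ≤ 1 :=
    le_of_mul_le_mul_right ((hp.trans (bound s p)).trans_eq (one_mul _).symm) hn
  rw [div_lt_iff₀ (by positivity)] at hs
  linarith

/-! ### The counting lemma -/

theorem exists_abs_sum_mul_le {V : Type*} [Fintype V] (A d : V → ℝ) (hA0 : ∀ u, 0 ≤ A u)
    (hA1 : ∀ u, A u ≤ 1) : ∃ S : Finset V, |∑ u, A u * d u| ≤ |∑ u ∈ S, d u| := by
  classical
  have hup : ∑ u, A u * d u ≤ ∑ u with 0 < d u, d u := by
    rw [sum_filter]
    refine sum_le_sum fun u _ => ?_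
    split_ifs with h
    · nlinarith [hA1 u]
    · nlinarith [hA0 u]
  have hlo : ∑ u with d u < 0, d u ≤ ∑ u, A u * d u := by
    rw [sum_filter]
    refine sum_le_sum fun u _ => ?_
    split_ifs with h
    · nlinarith [hA1 u]
    · nlinarith [hA0 u]
  rcases le_total 0 (∑ u, A u * d u) with h | h
  · exact ⟨univ.filter (0 < d ·), (abs_of_nonneg h).trans_le (hup.trans (le_abs_self _))⟩
  · exact ⟨univ.filter (d · < 0), (abs_of_nonpos h).trans_le
      ((neg_le_neg hlo).trans (neg_le_abs _))⟩

/-- A bound on all sums of `D` over rectangles gives the same bound when the indicator functions of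
the two sides are replaced by `[0, 1]`-valued functions. -/
theorem abs_sum_sum_mul_mul_le {V : Type*} [Fintype V] {D : V → V → ℝ} {c : ℝ}
    (hD : ∀ S T : Finset V, |∑ u ∈ S, ∑ v ∈ T, D u v| ≤ c) (A B : V → ℝ)
    (hA0 : ∀ u, 0 ≤ A u) (hA1 : ∀ u, A u ≤ 1) (hB0 : ∀ u, 0 ≤ B u) (hB1 : ∀ u, B u ≤ 1) :
    |∑ u, ∑ v, D u v * (A u * B v)| ≤ c := by
  obtain ⟨S, hS⟩ := exists_abs_sum_mul_le A (fun u => ∑ v, D u v * B v) hA0 hA1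
  obtain ⟨T, hT⟩ := exists_abs_sum_mul_le B (fun v => ∑ u ∈ S, D u v) hB0 hB1
  calc |∑ u, ∑ v, D u v * (A u * B v)| = |∑ u, A u * ∑ v, D u v * B v| := by
        simp only [mul_sum]
        congr 1
        exact sum_congr rfl fun u _ => sum_congr rfl fun v _ => by ring
    _ ≤ |∑ u ∈ S, ∑ v, D u v * B v| := hS
    _ = |∑ v, B v * ∑ u ∈ S, D u v| := by
        rw [sum_comm]
        simp only [mul_sum, mul_comm]
    _ ≤ |∑ v ∈ T, ∑ u ∈ S, D u v| := hT
    _ ≤ c := by rw [sum_comm]; exact hD S T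

/-- A kernel of small cut norm placed on a single edge makes the weighted homomorphism count
small: once the images of all vertices other than `a` and `b` are fixed, the remaining factors
split into a function of the image of `a` and a function of the image of `b`. -/
theorem abs_sum_mul_prod_le {V W : Type*} [Fintype V] [Nonempty V] [Fintype W] [DecidableEq W]
    (E : Finset (Sym2 W)) {a b : W} (hab : a ≠ b) (hE : s(a, b) ∉ E)
    (k : Sym2 W → Sym2 V → ℝ) (hk0 : ∀ e x, 0 ≤ k e x) (hk1 : ∀ e x, k e x ≤ 1)
    (D : Sym2 V → ℝ) {c : ℝ}
    (hD : ∀ S T : Finset V, |∑ u ∈ S, ∑ v ∈ T, D s(u, v)| ≤ c * (Fintype.card V : ℝ) ^ 2) :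
    |∑ φ : W → V, D s(φ a, φ b) * ∏ e ∈ E, k e (e.map φ)| ≤
      c * (Fintype.card V : ℝ) ^ Fintype.card W := by
  have hn : (0 : ℝ) < Fintype.card V := by exact_mod_cast Fintype.card_pos
  set A : (W → V) → V → ℝ := fun ψ u =>
    ∏ e ∈ E with b ∉ e, k e (e.map (Function.update ψ a u)) with hA
  set B : (W → V) → V → ℝ := fun ψ v =>
    ∏ e ∈ E with ¬ b ∉ e, k e (e.map (Function.update ψ b v)) with hB
  have hsplit : ∀ ψ u v,
      D s((Function.update (Function.update ψ a u) b v) a,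
        (Function.update (Function.update ψ a u) b v) b) *
        ∏ e ∈ E, k e (e.map (Function.update (Function.update ψ a u) b v)) =
      D s(u, v) * (A ψ u * B ψ v) := by
    intro ψ u v
    rw [Function.update_self, Function.update_of_ne hab, Function.update_self,
      ← prod_filter_mul_prod_filter_not E (fun e => b ∉ e)]
    congr 2
    · refine prod_congr rfl fun e he => ?_
      rw [mem_filter] at he
      congr 1
      refine Sym2.map_congr fun x hx => ?_
      rw [Function.update_of_ne]
      rintro rfl
      exact he.2 hx
    · refine prod_congr rfl fun e he => ?_
      rw [mem_filter, not_not] at he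
      congr 1
      refine Sym2.map_congr fun x hx => ?_
      by_cases hxb : x = b
      · subst hxb; simp
      · rw [Function.update_of_ne hxb, Function.update_of_ne hxb, Function.update_of_ne]
        rintro rfl
        exact hE (((Sym2.mem_and_mem_iff hab).mp ⟨hx, he.2⟩) ▸ he.1)
  have hres := sum_sum_sum_update (A := fun _ : W => V) a b
    (fun φ => D s(φ a, φ b) * ∏ e ∈ E, k e (e.map φ))
  simp only [hsplit] at hres
  have hle : |∑ ψ : W → V, ∑ u, ∑ v, D s(u, v) * (A ψ u * B ψ v)| ≤
      (Fintype.card V : ℝ) ^ Fintype.card W * (c * (Fintype.card V : ℝ) ^ 2) := by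
    refine (abs_sum_le_sum_abs _ _).trans ?_
    refine (sum_le_sum fun ψ _ => abs_sum_sum_mul_mul_le hD (A ψ) (B ψ)
      (fun u => prod_nonneg fun e _ => hk0 _ _)
      (fun u => prod_le_one (fun e _ => hk0 _ _) fun e _ => hk1 _ _)
      (fun u => prod_nonneg fun e _ => hk0 _ _)
      (fun u => prod_le_one (fun e _ => hk0 _ _) fun e _ => hk1 _ _)).trans ?_
    simp
  rw [hres, abs_mul, abs_mul, abs_of_pos hn] at hle
  refine le_of_mul_le_mul_left (a := (Fintype.card V : ℝ) ^ 2) ?_ (by positivity)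
  linarith

/-- Counting lemma: kernels that are close in cut norm have close weighted homomorphism counts. -/
theorem abs_sum_prod_sub_le {V W : Type*} [Fintype V] [Nonempty V] [Fintype W]
    [DecidableEq W] (E : Finset (Sym2 W)) (hE : ∀ e ∈ E, ¬ e.IsDiag) (g g' : Sym2 V → ℝ)
    (hg0 : ∀ x, 0 ≤ g x) (hg1 : ∀ x, g x ≤ 1) (hg0' : ∀ x, 0 ≤ g' x) (hg1' : ∀ x, g' x ≤ 1)
    {c : ℝ} (hD : ∀ S T : Finset V,
      |∑ u ∈ S, ∑ v ∈ T, (g s(u, v) - g' s(u, v))| ≤ c * (Fintype.card V : ℝ) ^ 2) :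
    |∑ φ : W → V, ∏ e ∈ E, g (e.map φ) - ∑ φ : W → V, ∏ e ∈ E, g' (e.map φ)| ≤
      #E * (c * (Fintype.card V : ℝ) ^ Fintype.card W) := by
  -- The kernel `g'` is replaced by `g` on one edge at a time; `T` holds the edges already treated.
  let k : Finset (Sym2 W) → Sym2 W → Sym2 V → ℝ := fun T e x => if e ∈ T then g x else g' x
  have hk0 : ∀ T e x, 0 ≤ k T e x := fun T e x => by
    simp only [k]; split_ifs; exacts [hg0 x, hg0' x]
  have hk1 : ∀ T e x, k T e x ≤ 1 := fun T e x => by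
    simp only [k]; split_ifs; exacts [hg1 x, hg1' x]
  have key : ∀ T ⊆ E,
      |∑ φ : W → V, ∏ e ∈ E, k T e (e.map φ) - ∑ φ : W → V, ∏ e ∈ E, g' (e.map φ)| ≤
        #T * (c * (Fintype.card V : ℝ) ^ Fintype.card W) := by
    intro T
    induction T using Finset.induction_on with
    | empty => simp [k]
    | insert e T heT ih =>
      intro hT
      have heE : e ∈ E := hT (mem_insert_self _ _)
      have ih := ih ((subset_insert _ _).trans hT)
      have hstep : |∑ φ : W → V, ∏ f ∈ E, k (insert e T) f (f.map φ) -
          ∑ φ : W → V, ∏ f ∈ E, k T f (f.map φ)| ≤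
          c * (Fintype.card V : ℝ) ^ Fintype.card W := by
        have hrew : ∑ φ : W → V, ∏ f ∈ E, k (insert e T) f (f.map φ) -
            ∑ φ : W → V, ∏ f ∈ E, k T f (f.map φ) =
            ∑ φ : W → V, (g (e.map φ) - g' (e.map φ)) *
              ∏ f ∈ E.erase e, k T f (f.map φ) := by
          rw [← sum_sub_distrib]
          refine sum_congr rfl fun φ _ => ?_
          rw [← mul_prod_erase _ _ heE, ← mul_prod_erase _ (fun f => k T f (f.map φ)) heE, sub_mul]
          congr 1
          · congr 1
            · simp [k]
            · refine prod_congr rfl fun f hf => ?_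
              simp [k, (mem_erase.mp hf).1]
          · simp [k, heT]
        rw [hrew]
        have hdiag := hE e heE
        clear hrew ih hT
        induction e using Sym2.ind with
        | _ a b =>
          exact abs_sum_mul_prod_le (E.erase s(a, b)) (by simpa using hdiag) (by simp) (k T)
            (hk0 T) (hk1 T) (fun x => g x - g' x) hD
      rw [card_insert_of_notMem heT]
      push_cast
      have := abs_sub_le (∑ φ : W → V, ∏ f ∈ E, k (insert e T) f (f.map φ))
        (∑ φ : W → V, ∏ f ∈ E, k T f (f.map φ)) (∑ φ : W → V, ∏ e ∈ E, g' (e.map φ))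
      linarith
  have h := key E subset_rfl
  have hE' : ∀ φ : W → V, ∏ e ∈ E, k E e (e.map φ) = ∏ e ∈ E, g (e.map φ) := fun φ =>
    prod_congr rfl fun e he => by simp [k, he]
  simpa only [hE'] using h

/-! ### Weak regularity and blow-ups of graphs -/

theorem two_mul_ncard_edgeSet {V : Type*} [Fintype V] (G : SimpleGraph V) [DecidableRel G.Adj] :
    2 * (G.edgeSet.ncard : ℝ) = ∑ u, ∑ v, (if G.Adj u v then (1 : ℝ) else 0) := by
  classical
  have h := G.two_mul_card_edgeFinset
  rw [SimpleGraph.edgeFinset, ← Set.ncard_eq_toFinset_card', card_filter] at h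
  rw [← sum_product', univ_product_univ]
  exact_mod_cast h

theorem condAvg_swap {V P : Type*} [Fintype V] [DecidableEq P] (p : V → P) {f : V × V → ℝ}
    (hf : ∀ x, f x.swap = f x) (x : V × V) :
    condAvg (Prod.map p p) f x.swap = condAvg (Prod.map p p) f x := by
  have hiff : ∀ y : V × V, Prod.map p p y.swap = Prod.map p p x.swap ↔
      Prod.map p p y = Prod.map p p x := fun y => by
    simp [Prod.map, and_comm]
  simp only [condAvg]
  congr 1
  · rw [sum_filter, sum_filter, ← Equiv.sum_comp (Equiv.prodComm V V)]
    simp only [Equiv.prodComm_apply, hiff, hf]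
  · congr 1
    rw [card_filter, card_filter, ← Equiv.sum_comp (Equiv.prodComm V V)]
    simp only [Equiv.prodComm_apply, hiff]

open scoped Classical in
/-- Weak regularity for a graph `G`. The kernel `w` is the density of `G` between the parts; it is
defined on `Sym2 V` because it is symmetric, and its values on the diagonal are the densities inside
the parts. -/
theorem exists_weak_regular_graph {V : Type*} [Fintype V] [Nonempty V] (G : SimpleGraph V)
    {η : ℝ} (hη : 0 < η) :
    ∃ s : ℕ, s * η ^ 2 ≤ 1 ∧ ∃ (p : V → (Fin s → Bool × Bool)) (w : Sym2 V → ℝ),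
      (∀ x, 0 ≤ w x) ∧ (∀ x, w x ≤ 1) ∧
      (∀ u u' v v', p u = p u' → p v = p v' → w s(u, v) = w s(u', v')) ∧
      (∀ S T : Finset V,
        |∑ u ∈ S, ∑ v ∈ T, ((if s(u, v) ∈ G.edgeSet then 1 else 0) - w s(u, v))| ≤
          η * (Fintype.card V : ℝ) ^ 2) ∧
      ∀ θ : ℝ, 0 ≤ θ →
        ∑ u, ∑ v, (if G.Adj u v ∧ w s(u, v) < θ then (1 : ℝ) else 0) ≤
          θ * (Fintype.card V : ℝ) ^ 2 := by
  let f : V × V → ℝ := fun x => if s(x.1, x.2) ∈ G.edgeSet then 1 else 0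
  have hf0 : ∀ x, 0 ≤ f x := fun x => by simp only [f]; split_ifs <;> norm_num
  have hf1 : ∀ x, f x ≤ 1 := fun x => by simp only [f]; split_ifs <;> norm_num
  have hfs : ∀ x, f x.swap = f x := fun x => by
    simp only [f, Prod.fst_swap, Prod.snd_swap, Sym2.eq_swap]
  obtain ⟨s, hs, p, hp⟩ := exists_weak_regular f hf0 hf1 hη
  refine ⟨s, hs, p, Sym2.lift ⟨fun u v => condAvg (Prod.map p p) f (u, v), fun u v =>
    (condAvg_swap p hfs (u, v)).symm⟩, ?_, ?_, ?_, hp, ?_⟩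
  · intro x
    induction x using Sym2.ind with
    | _ u v => exact condAvg_nonneg _ hf0 _
  · intro x
    induction x using Sym2.ind with
    | _ u v => exact condAvg_le_one _ hf1 _
  · intro u u' v v' hu hv
    exact condAvg_congr _ _ (by simp [hu, hv])
  · intro θ hθ
    have h := sum_condAvg_mul (Prod.map p p) f
      (fun x => if condAvg (Prod.map p p) f x < θ then 1 else 0)
      (fun x y hxy => by simp only [condAvg_congr _ f hxy])
    calc ∑ u, ∑ v, (if G.Adj u v ∧ condAvg (Prod.map p p) f (u, v) < θ then (1 : ℝ) else 0)
        = ∑ x, f x * (if condAvg (Prod.map p p) f x < θ then 1 else 0) := by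
          rw [Fintype.sum_prod_type]
          refine sum_congr rfl fun u _ => sum_congr rfl fun v _ => ?_
          simp only [f, SimpleGraph.mem_edgeSet, ite_and]
          split_ifs <;> simp
      _ = ∑ x, condAvg (Prod.map p p) f x * (if condAvg (Prod.map p p) f x < θ then 1 else 0) :=
          h.symm
      _ ≤ ∑ _x : V × V, θ := by
          refine sum_le_sum fun x _ => ?_
          split_ifs with hx
          · linarith
          · simpa using hθ
      _ = θ * (Fintype.card V : ℝ) ^ 2 := by
          simp [Fintype.card_prod]
          ring

/-- The `t`-fold blow-up of the graph of dense pairs: distinct vertices of `V × Fin t` are joined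
when the kernel `w` is at least `θ` at their projections to `V`. Two vertices with the same
projection may be joined, since the parts of a regular partition may be dense. -/
def denseGraph {V : Type*} (w : Sym2 V → ℝ) (θ : ℝ) (t : ℕ) : SimpleGraph (V × Fin t) where
  Adj x y := x ≠ y ∧ θ ≤ w s(x.1, y.1)
  symm := ⟨fun x y h => ⟨h.1.symm, by rw [Sym2.eq_swap]; exact h.2⟩⟩
  loopless := ⟨fun x h => h.1 rfl⟩

open scoped Classical in
/-- Every copy of `H` in the dense graph contributes at least `θ ^ e(H)` to the weighted
homomorphism count of `w`. -/
theorem pow_mul_labelledCopyCount_le {V W : Type*} [Fintype V] [Fintype W] (H : SimpleGraph W)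
    {w : Sym2 V → ℝ} (hw : ∀ x, 0 ≤ w x) {θ : ℝ} (hθ : 0 ≤ θ) (t : ℕ) :
    θ ^ H.edgeSet.ncard * ((denseGraph w θ t).labelledCopyCount H : ℝ) ≤
      (t : ℝ) ^ Fintype.card W * ∑ φ : W → V, ∏ e ∈ H.edgeFinset, w (e.map φ) := by
  have hnn : ∀ φ : W → V, 0 ≤ ∏ e ∈ H.edgeFinset, w (e.map φ) := fun φ =>
    prod_nonneg fun e _ => hw _
  let good : Finset (W → V × Fin t) :=
    {f | θ ^ H.edgeSet.ncard ≤ ∏ e ∈ H.edgeFinset, w (e.map (Prod.fst ∘ f))}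
  have hcount : (denseGraph w θ t).labelledCopyCount H ≤ #good := by
    rw [SimpleGraph.labelledCopyCount, Fintype.card_eq_nat_card, ← Fintype.card_coe,
      Fintype.card_eq_nat_card]
    refine Nat.card_le_card_of_injective (fun f => ⟨f, ?_⟩) ?_
    · simp only [good, mem_filter, mem_univ, true_and]
      rw [Set.ncard_eq_toFinset_card', ← SimpleGraph.edgeFinset, ← prod_const]
      refine prod_le_prod (fun _ _ => hθ) fun e he => ?_
      rw [SimpleGraph.mem_edgeFinset] at he
      induction e using Sym2.ind with
      | _ a b => exact (f.toHom.map_adj he).2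
    · intro f f' h
      ext x : 1
      exact congrFun (Subtype.ext_iff.mp h) x
  calc θ ^ H.edgeSet.ncard * ((denseGraph w θ t).labelledCopyCount H : ℝ)
      ≤ ∑ f ∈ good, θ ^ H.edgeSet.ncard := by
        rw [sum_const, nsmul_eq_mul, mul_comm]
        exact mul_le_mul_of_nonneg_right (by exact_mod_cast hcount) (pow_nonneg hθ _)
    _ ≤ ∑ f ∈ good, ∏ e ∈ H.edgeFinset, w (e.map (Prod.fst ∘ f)) :=
        sum_le_sum fun f hf => (mem_filter.mp hf).2
    _ ≤ ∑ f : W → V × Fin t, ∏ e ∈ H.edgeFinset, w (e.map (Prod.fst ∘ f)) :=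
        sum_le_sum_of_subset_of_nonneg (subset_univ _) fun f _ _ => hnn _
    _ = ∑ z : (W → V) × (W → Fin t), ∏ e ∈ H.edgeFinset, w (e.map z.1) :=
        Fintype.sum_equiv (Equiv.arrowProdEquivProdArrow W (fun _ => V) (fun _ => Fin t)) _ _
          fun f => rfl
    _ = (t : ℝ) ^ Fintype.card W * ∑ φ : W → V, ∏ e ∈ H.edgeFinset, w (e.map φ) := by
        rw [Fintype.sum_prod_type]
        simp [mul_sum]

open scoped Classical in
/-- If the dense graph is close to a graph `Γ'`, then `G` has an approximate homomorphism to a graph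
induced by `Γ'` on random representatives of the parts. The parts are first split by a random
colouring with `k` colours, so that few edges of `G` stay inside a part. -/
theorem exists_approxHom_of_dense_close {V P : Type} [Fintype V] [Fintype P]
    (G : SimpleGraph V) (p : V → P) (w : Sym2 V → ℝ)
    (hw : ∀ u u' v v', p u = p u' → p v = p v' → w s(u, v) = w s(u', v')) {θ : ℝ} (hθ : 0 < θ)
    (hsparse : ∑ u, ∑ v, (if G.Adj u v ∧ w s(u, v) < θ then (1 : ℝ) else 0) ≤
      θ * (Fintype.card V : ℝ) ^ 2)
    {k t : ℕ} (hk : 1 / θ ≤ k) (ht : 0 < t) (Γ' : SimpleGraph (V × Fin t))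
    (hclose : IsClose θ (denseGraph w θ t) Γ') :
    ∃ (X : Type) (_ : Fintype X) (Γ : SimpleGraph X) (φ : V → X),
      Fintype.card X ≤ Fintype.card P * k ∧ Nonempty (Γ →g Γ') ∧ IsApproxHom (2 * θ) G Γ φ := by
  have hk0 : (0 : ℝ) < k := lt_of_lt_of_le (by positivity) hk
  have ht' : (0 : ℝ) < t := by exact_mod_cast ht
  obtain ⟨c, hc⟩ := exists_coloring (V := V) (k := k) (by exact_mod_cast hk0)
  let ψ : V → P × Fin k := fun v => (p v, c v)
  let φ : V → Set.range ψ := Set.rangeFactorization ψ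
  have hφ : ∀ u v, φ u = φ v ↔ p u = p v ∧ c u = c v := fun u v => by
    simp [φ, ψ, Set.rangeFactorization, Subtype.ext_iff]
  have hsurj : Function.Surjective (fun x : V × Fin t => φ x.1) := by
    rintro ⟨_, v, rfl⟩
    exact ⟨(v, ⟨0, ht⟩), rfl⟩
  set B : V × Fin t → V × Fin t → ℝ := fun x y =>
    if (denseGraph w θ t \ Γ').Adj x y then 1 else 0 with hB
  have hB0 : ∀ x y, 0 ≤ B x y := fun x y => by simp only [hB]; split_ifs <;> norm_num
  obtain ⟨r, hr, hrB⟩ := exists_representatives hsurj B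
  refine ⟨Set.range ψ, inferInstance, Γ'.comap r, φ, ?_, ⟨⟨r, fun h => h⟩⟩, ?_⟩
  · calc Fintype.card (Set.range ψ) ≤ Fintype.card (P × Fin k) :=
          Fintype.card_le_of_injective _ Subtype.val_injective
      _ = Fintype.card P * k := by simp
  -- The contribution of the dense pairs that the representatives fail to join.
  have hrep : ∑ u, ∑ v, (if φ u ≠ φ v then B (r (φ u)) (r (φ v)) else 0) ≤
      2 * θ * (Fintype.card V : ℝ) ^ 2 := by
    have h1 : ∑ x : V × Fin t, ∑ y : V × Fin t,
        (if φ x.1 ≠ φ y.1 then B (r (φ x.1)) (r (φ y.1)) else 0) =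
        (t : ℝ) ^ 2 * ∑ u, ∑ v, (if φ u ≠ φ v then B (r (φ u)) (r (φ v)) else 0) := by
      simp only [Fintype.sum_prod_type, sum_const, card_univ, Fintype.card_fin, nsmul_eq_mul,
        ← mul_sum]
      ring
    have h2 : ∑ x : V × Fin t, ∑ y : V × Fin t, (if φ x.1 ≠ φ y.1 then B x y else 0) ≤
        2 * ((denseGraph w θ t \ Γ').edgeSet.ncard : ℝ) := by
      rw [two_mul_ncard_edgeSet]
      refine sum_le_sum fun x _ => sum_le_sum fun y _ => ?_
      by_cases h : φ x.1 = φ y.1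
      · rw [if_neg (not_not.mpr h)]
        exact hB0 x y
      · simp [h, hB]
    have h3 : ((denseGraph w θ t \ Γ').edgeSet.ncard : ℝ) ≤
        θ * ((Fintype.card V : ℝ) * t) ^ 2 := by
      have hc' := hclose
      rw [IsClose, Fintype.card_prod, Fintype.card_fin] at hc'
      push_cast at hc'
      refine le_trans ?_ hc'
      rw [SimpleGraph.edgeSet_sdiff]
      exact_mod_cast Set.ncard_le_ncard (Set.subset_union_left) (Set.toFinite _)
    refine le_of_mul_le_mul_left (a := (t : ℝ) ^ 2) ?_ (by positivity)
    rw [← h1]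
    refine (hrB.trans h2).trans ?_
    linarith
  have hbad : {e ∈ G.edgeSet | Sym2.map φ e ∉ (Γ'.comap r).edgeSet} =
      (G \ (Γ'.comap r).comap φ).edgeSet := by
    ext e
    induction e using Sym2.ind with
    | _ u v => simp
  have hpoint : ∀ u v, (if (G \ (Γ'.comap r).comap φ).Adj u v then (1 : ℝ) else 0) ≤
      (if G.Adj u v ∧ w s(u, v) < θ then (1 : ℝ) else 0) +
        (if u ≠ v ∧ c u = c v then (1 : ℝ) else 0) +
        (if φ u ≠ φ v then B (r (φ u)) (r (φ v)) else 0) := by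
    intro u v
    have n1 : (0 : ℝ) ≤ if G.Adj u v ∧ w s(u, v) < θ then (1 : ℝ) else 0 := by
      split_ifs <;> norm_num
    have n2 : (0 : ℝ) ≤ if u ≠ v ∧ c u = c v then (1 : ℝ) else 0 := by split_ifs <;> norm_num
    have n3 : (0 : ℝ) ≤ if φ u ≠ φ v then B (r (φ u)) (r (φ v)) else 0 := by
      split_ifs; exacts [hB0 _ _, le_rfl]
    by_cases hadj : (G \ (Γ'.comap r).comap φ).Adj u v
    · rw [if_pos hadj]
      rw [SimpleGraph.sdiff_adj] at hadj
      by_cases h1 : w s(u, v) < θ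
      · rw [if_pos ⟨hadj.1, h1⟩]; linarith
      · by_cases h2 : φ u = φ v
        · rw [if_neg fun h => h1 h.2, if_pos ⟨hadj.1.ne, ((hφ u v).mp h2).2⟩]; linarith
        · have hB1 : B (r (φ u)) (r (φ v)) = 1 := by
            simp only [hB, SimpleGraph.sdiff_adj]
            rw [if_pos]
            refine ⟨⟨?_, ?_⟩, hadj.2⟩
            · intro h
              exact h2 ((hr (φ u)).symm.trans ((congrArg (fun x => φ x.1) h).trans (hr (φ v))))
            · rw [hw _ u _ v ((hφ _ _).mp (hr (φ u))).1 ((hφ _ _).mp (hr (φ v))).1]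
              exact not_lt.mp h1
          rw [if_pos h2, hB1]; linarith
    · rw [if_neg hadj]; linarith
  have hsum : 2 * ((G \ (Γ'.comap r).comap φ).edgeSet.ncard : ℝ) ≤
      θ * (Fintype.card V : ℝ) ^ 2 + (Fintype.card V : ℝ) ^ 2 / k +
        2 * θ * (Fintype.card V : ℝ) ^ 2 := by
    rw [two_mul_ncard_edgeSet]
    refine (sum_le_sum fun u _ => sum_le_sum fun v _ => hpoint u v).trans ?_
    simp only [sum_add_distrib]
    exact add_le_add (add_le_add hsparse hc) hrep
  have hcol : (Fintype.card V : ℝ) ^ 2 / k ≤ θ * (Fintype.card V : ℝ) ^ 2 := by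
    rw [div_le_iff₀ hk0]
    rw [div_le_iff₀ hθ] at hk
    nlinarith [sq_nonneg (Fintype.card V : ℝ)]
  rw [IsApproxHom, hbad]
  linarith

/-! ### From many copies to approximate homomorphisms -/

theorem edgeSet_nonempty_of_homFree {V W : Type*} [Nonempty V] {H : SimpleGraph W}
    {G : SimpleGraph V} (hG : HomFree H G) : H.edgeSet.Nonempty := by
  by_contra hne
  rw [Set.not_nonempty_iff_eq_empty, SimpleGraph.edgeSet_eq_empty] at hne
  subst hne
  exact hG.elim ⟨fun _ => Classical.arbitrary V, fun h => h.elim⟩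

/-- An edge of `H` is mapped by `H → F` to an edge of `F`, which has no image in an edgeless
graph. -/
theorem homFree_bot_of_hom {V X U W : Type*} [Nonempty V] {H : SimpleGraph W} {F : SimpleGraph U}
    (f : H →g F) {G : SimpleGraph V} (hG : HomFree H G) :
    HomFree F (⊥ : SimpleGraph X) := by
  obtain ⟨e, he⟩ := edgeSet_nonempty_of_homFree hG
  induction e using Sym2.ind with
  | _ a b => exact ⟨fun g => (g.comp f).map_adj he⟩

/-- The target graph has at most `4 ^ s * k` vertices: the parts of the regular partition times the
colours. With `η = 5 / (2 K)` the number of increments satisfies `s ≤ 1 / η² = (4 / 25) K²`, which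
leaves room for `k` in the exponent. -/
theorem four_pow_mul_le {s k : ℕ} {K : ℝ} (hs : s * (25 / 4) ≤ K ^ 2) (hk : k ≤ K / 5 + 1)
    (hK : 5 ≤ K) : (4 : ℝ) ^ s * k ≤ (2 : ℝ) ^ (K ^ 2) := by
  have h4 : (4 : ℝ) ^ s = (2 : ℝ) ^ (2 * s : ℝ) := by
    rw [Real.rpow_mul (by norm_num), Real.rpow_natCast]
    norm_num
  have hk2 : (k : ℝ) ≤ (2 : ℝ) ^ K := by
    have := one_add_mul_self_le_rpow_one_add (s := 1) (by norm_num) (p := K) (by linarith)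
    norm_num at this
    linarith
  calc (4 : ℝ) ^ s * k ≤ (2 : ℝ) ^ (2 * s : ℝ) * (2 : ℝ) ^ K := by
        rw [h4]
        exact mul_le_mul_of_nonneg_left hk2 (by positivity)
    _ = (2 : ℝ) ^ (2 * s + K : ℝ) := (Real.rpow_add (by norm_num) _ _).symm
    _ ≤ (2 : ℝ) ^ (K ^ 2) := by
        refine Real.rpow_le_rpow_of_exponent_le (by norm_num) ?_
        nlinarith

/-- The removal hypothesis at the single parameter `ε / 2` gives an approximate homomorphism with
error `ε`: in ordered pairs, at most `(ε / 2) |V|²` edges are lost to sparse pairs, `(ε / 2) |V|²`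
to pairs inside a part, and `ε |V|²` to the distance from an `F`-hom-free graph. -/
theorem exists_approxHom_of_homFree {V : Type} {U W : Type*} [Fintype V] [Nonempty V] [Fintype W]
    {F : SimpleGraph U} {H : SimpleGraph W} {ε δ : ℝ} (hε0 : 0 < ε) (hε2 : ε < 2) (hδ0 : 0 < δ)
    (hδ1 : δ < 1) (hfar : FarImpliesManyCopies (fun G => HomFree F G) H (ε / 2) δ)
    {G : SimpleGraph V} (hG : HomFree H G) :
    ∃ (X : Type) (_ : Fintype X) (Γ : SimpleGraph X) (φ : V → X),
      (Fintype.card X : ℝ) ≤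
        (2 : ℝ) ^ ((5 * (H.edgeSet.ncard : ℝ) * (2 / ε) ^ H.edgeSet.ncard / δ) ^ 2) ∧
      HomFree F Γ ∧ IsApproxHom ε G Γ φ := by
  classical
  have he : 1 ≤ H.edgeSet.ncard :=
    (Set.ncard_pos (Set.toFinite _)).mpr (edgeSet_nonempty_of_homFree hG)
  have hE : #H.edgeFinset = H.edgeSet.ncard := by
    rw [Set.ncard_eq_toFinset_card', SimpleGraph.edgeFinset]
  set e := H.edgeSet.ncard with he_def
  have he' : (1 : ℝ) ≤ e := by exact_mod_cast he
  have hθ : 0 < ε / 2 := by linarith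
  -- This `η` makes the counting error half of the guaranteed number of copies.
  set η : ℝ := δ * (ε / 2) ^ e / (2 * e) with hη_def
  have hη : 0 < η := by positivity
  set K : ℝ := 5 * (e : ℝ) * (2 / ε) ^ e / δ with hK_def
  have hKη : K * η = 5 / 2 := by
    have : (2 / ε) ^ e * (ε / 2) ^ e = 1 := by
      rw [← mul_pow, div_mul_div_cancel₀ hε0.ne', div_self (by norm_num), one_pow]
    calc K * η = 5 / 2 * ((2 / ε) ^ e * (ε / 2) ^ e) * (e / e) * (δ / δ) := by
          rw [hK_def, hη_def]; ring
      _ = 5 / 2 := by rw [this, div_self hδ0.ne', div_self (by positivity)]; norm_num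
  have hK : 5 * (2 / ε) ≤ K := by
    have h1 : 1 ≤ 2 / ε := by rw [le_div_iff₀ hε0]; linarith
    have h2 : 2 / ε ≤ (2 / ε) ^ e := le_self_pow₀ h1 (by omega)
    rw [hK_def, le_div_iff₀ hδ0]
    have h3 : 2 / ε * δ ≤ 2 / ε := mul_le_of_le_one_right (by linarith) hδ1.le
    nlinarith
  obtain ⟨s, hs, p, w, hw0, hw1, hwp, hcut, hsparse⟩ := exists_weak_regular_graph G hη
  have hn : (0 : ℝ) < Fintype.card V := by exact_mod_cast Fintype.card_pos
  have hhom : ∑ φ : W → V, ∏ e ∈ H.edgeFinset, w (e.map φ) ≤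
      δ * (ε / 2) ^ e / 2 * (Fintype.card V : ℝ) ^ Fintype.card W := by
    have h := abs_sum_prod_sub_le (W := W) H.edgeFinset
      (fun e he => H.not_isDiag_of_mem_edgeSet (SimpleGraph.mem_edgeFinset.mp he))
      (fun x => if x ∈ G.edgeSet then 1 else 0) w
      (fun x => by split_ifs <;> norm_num) (fun x => by split_ifs <;> norm_num) hw0 hw1 hcut
    rw [sum_eq_zero, zero_sub, abs_neg, hE] at h
    · refine (le_abs_self _).trans (h.trans_eq ?_)
      rw [hη_def]
      field_simp
    · intro φ _
      by_contra hne
      rw [← ne_eq, prod_ne_zero_iff] at hne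
      refine hG.elim ⟨φ, fun {a b} hab => ?_⟩
      simpa using hne s(a, b) (by simpa using hab)
  obtain ⟨n₀, hn₀⟩ := hfar
  set t := max n₀ 1 with ht_def
  have ht : 0 < t := by omega
  have ht' : (0 : ℝ) < t := by exact_mod_cast ht
  have hclose : ∃ Γ' : SimpleGraph (V × Fin t), HomFree F Γ' ∧
      IsClose (ε / 2) (denseGraph w (ε / 2) t) Γ' := by
    by_contra! hnot
    have h1 := hn₀ (V × Fin t) (denseGraph w (ε / 2) t) (by
      rw [Fintype.card_prod, Fintype.card_fin]
      exact (le_max_left _ _).trans (Nat.le_mul_of_pos_left _ Fintype.card_pos)) hnot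
    rw [Fintype.card_prod, Fintype.card_fin] at h1
    have h2 := pow_mul_labelledCopyCount_le H hw0 hθ.le t
    have h3 := mul_le_mul_of_nonneg_left h1 (pow_nonneg hθ.le e)
    have h4 := mul_le_mul_of_nonneg_left hhom (pow_nonneg ht'.le (Fintype.card W))
    push_cast at h3
    rw [mul_pow] at h3
    have hpos : 0 < (ε / 2) ^ e * (δ * ((Fintype.card V : ℝ) ^ Fintype.card W *
        (t : ℝ) ^ Fintype.card W)) := by positivity
    have h5 := h3.trans (h2.trans h4)
    linarith
  obtain ⟨Γ', hΓ', hcl⟩ := hclose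
  obtain ⟨X, hX, Γ, φ, hcard, ⟨f⟩, hφ⟩ := exists_approxHom_of_dense_close G p w hwp hθ
    (hsparse _ hθ.le) (k := ⌈2 / ε⌉₊) (by rw [one_div_div]; exact Nat.le_ceil _) ht Γ' hcl
  refine ⟨X, hX, Γ, φ, ?_, ⟨fun g => hΓ'.elim (f.comp g)⟩, by
    rwa [mul_div_cancel₀ _ (by norm_num : (2 : ℝ) ≠ 0)] at hφ⟩
  have hcard' : (Fintype.card X : ℝ) ≤ (4 : ℝ) ^ s * ⌈2 / ε⌉₊ := by
    have : Fintype.card (Fin s → Bool × Bool) = 4 ^ s := by simp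
    rw [this] at hcard
    exact_mod_cast hcard
  have h1 : 1 ≤ 2 / ε := by rw [le_div_iff₀ hε0]; linarith
  refine hcard'.trans (four_pow_mul_le ?_ ?_ (by linarith))
  · have : (s : ℝ) * (25 / 4) = s * η ^ 2 * K ^ 2 := by
      linear_combination (-(s : ℝ)) * (K * η + 5 / 2) * hKη
    rw [this]
    exact mul_le_of_le_one_left (sq_nonneg _) hs
  · have := (Nat.ceil_lt_add_one (show 0 ≤ 2 / ε by linarith)).le
    linarith

/-- Only nonempty graphs need to be considered when bounding `approxHomNumber`. -/
theorem approxHomBounds_nonempty_and_le {U W : Type*} {F : SimpleGraph U} {H : SimpleGraph W}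
    (hHF : Nonempty (H →g F)) {ε b : ℝ} (hb : 0 ≤ b)
    (h : ∀ (V : Type) [Fintype V] [Nonempty V] (G : SimpleGraph V), HomFree H G →
      ∃ (X : Type) (_ : Fintype X) (Γ : SimpleGraph X) (φ : V → X),
        (Fintype.card X : ℝ) ≤ b ∧ HomFree F Γ ∧ IsApproxHom ε G Γ φ) :
    (approxHomBounds F H ε).Nonempty ∧ (approxHomNumber F H ε : ℝ) ≤ b := by
  have hmem : ⌊b⌋₊ ∈ approxHomBounds F H ε := by
    intro V _ G hG
    rcases isEmpty_or_nonempty V with hV | hV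
    · obtain ⟨f⟩ := hHF
      refine ⟨Empty, inferInstance, ⊥, isEmptyElim, by simp, ⟨fun g => ?_⟩, ?_⟩
      · -- A homomorphism from `F` to the empty graph forces `H` to have no vertices.
        exact hG.elim ⟨fun a => (g (f a)).elim, fun {a} => (g (f a)).elim⟩
      · simp [IsApproxHom]
    · obtain ⟨X, hX, Γ, φ, hcard, hΓ⟩ := h V G hG
      exact ⟨X, hX, Γ, φ, Nat.le_floor hcard, hΓ⟩
  exact ⟨⟨_, hmem⟩, (Nat.cast_le.mpr (Nat.sInf_le hmem)).trans (Nat.floor_le hb)⟩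

theorem approxHomNumber_le {U W : Type*} [Fintype W] {F : SimpleGraph U} {H : SimpleGraph W}
    (hHF : Nonempty (H →g F)) {ε δ : ℝ} (hε0 : 0 < ε) (hε2 : ε < 2) (hδ0 : 0 < δ) (hδ1 : δ < 1)
    (hfar : FarImpliesManyCopies (fun G => HomFree F G) H (ε / 2) δ) :
    (approxHomBounds F H ε).Nonempty ∧ (approxHomNumber F H ε : ℝ) ≤
      (2 : ℝ) ^ ((5 * (H.edgeSet.ncard : ℝ) * (2 / ε) ^ H.edgeSet.ncard / δ) ^ 2) :=
  approxHomBounds_nonempty_and_le hHF (by positivity) fun _ _ _ _ hG =>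
    exists_approxHom_of_homFree hε0 hε2 hδ0 hδ1 hfar hG

/-- For `ε ≥ 2` a single vertex suffices, since a graph has at most `|V|²` edges. -/
theorem approxHomNumber_le_one {U W : Type*} {F : SimpleGraph U} {H : SimpleGraph W}
    (hHF : Nonempty (H →g F)) {ε : ℝ} (hε : 2 ≤ ε) :
    (approxHomBounds F H ε).Nonempty ∧ (approxHomNumber F H ε : ℝ) ≤ 1 := by
  classical
  refine approxHomBounds_nonempty_and_le hHF zero_le_one fun V _ _ G hG =>
    ⟨Unit, inferInstance, ⊥, fun _ => (), by simp, homFree_bot_of_hom hHF.some hG, ?_⟩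
  have h1 : ({e ∈ G.edgeSet | Sym2.map (fun _ => ()) e ∉ (⊥ : SimpleGraph Unit).edgeSet}.ncard : ℝ)
      ≤ G.edgeSet.ncard := by
    exact_mod_cast Set.ncard_le_ncard (Set.sep_subset _ _) (Set.toFinite _)
  have h2 : 2 * (G.edgeSet.ncard : ℝ) ≤ (Fintype.card V : ℝ) ^ 2 := by
    rw [two_mul_ncard_edgeSet]
    calc ∑ u, ∑ v, (if G.Adj u v then (1 : ℝ) else 0) ≤ ∑ _u : V, ∑ _v : V, (1 : ℝ) :=
          sum_le_sum fun u _ => sum_le_sum fun v _ => by split_ifs <;> norm_num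
      _ = (Fintype.card V : ℝ) ^ 2 := by simp [sq]
  rw [IsApproxHom]
  nlinarith [sq_nonneg (Fintype.card V : ℝ)]

theorem FarImpliesManyCopies.mono {W : Type*} [Fintype W]
    {P Q : ∀ {V : Type}, SimpleGraph V → Prop} {H : SimpleGraph W} {ε d d' : ℝ} (hd : d' ≤ d)
    (hPQ : ∀ (V : Type) (G : SimpleGraph V), P G → Q G)
    (h : FarImpliesManyCopies P H ε d) : FarImpliesManyCopies Q H ε d' := by
  obtain ⟨n₀, hn₀⟩ := h
  refine ⟨n₀, fun V _ G hV hfar => ?_⟩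
  exact (mul_le_mul_of_nonneg_right hd (by positivity)).trans
    (hn₀ V G hV fun G' hG' => hfar G' (hPQ V G' hG'))

theorem homFree_top_of_free {U V : Type*} {G : SimpleGraph V}
    (h : (⊤ : SimpleGraph U).Free G) : HomFree (⊤ : SimpleGraph U) G :=
  ⟨fun f => h ⟨f, f.injective_of_top_hom⟩⟩

/-- The exponent obtained from a power bound `δ(ε) = a * ε ^ C` is a power of `1 / ε`. -/
theorem sq_le_mul_rpow {ε a C δ : ℝ} (e : ℕ) (hε0 : 0 < ε) (ha : 0 < a)
    (hδ : a * (ε / 2) ^ C ≤ δ) :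
    (5 * (e : ℝ) * (2 / ε) ^ e / δ) ^ 2 ≤
      ((5 * (e : ℝ) * (2 : ℝ) ^ (e + C) / a) ^ 2 + 1) * (1 / ε) ^ (2 * (e + C)) := by
  have hδ0 : 0 < δ := lt_of_lt_of_le (by positivity) hδ
  have h1 : (2 / ε) ^ e * (2 / ε) ^ C = (2 : ℝ) ^ (e + C) * (1 / ε) ^ (e + C) := by
    rw [← Real.rpow_natCast, ← Real.rpow_add (by positivity), ← Real.mul_rpow (by norm_num)
      (by positivity), mul_one_div]
  have h2 : (2 / ε) ^ C * (ε / 2) ^ C = 1 := by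
    rw [← Real.mul_rpow (by positivity) (by positivity), div_mul_div_cancel₀ hε0.ne',
      div_self (by norm_num), Real.one_rpow]
  have h3 : 5 * (e : ℝ) * (2 / ε) ^ e / δ ≤
      5 * (e : ℝ) * (2 : ℝ) ^ (e + C) / a * (1 / ε) ^ (e + C) := by
    calc 5 * (e : ℝ) * (2 / ε) ^ e / δ ≤ 5 * (e : ℝ) * (2 / ε) ^ e / (a * (ε / 2) ^ C) := by
          gcongr
      _ = 5 * (e : ℝ) * ((2 / ε) ^ e * (2 / ε) ^ C) / a := by
          rw [div_eq_div_iff (by positivity) ha.ne']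
          linear_combination (-(5 * (e : ℝ) * (2 / ε) ^ e * a)) * h2
      _ = _ := by rw [h1]; ring
  calc (5 * (e : ℝ) * (2 / ε) ^ e / δ) ^ 2
      ≤ (5 * (e : ℝ) * (2 : ℝ) ^ (e + C) / a * (1 / ε) ^ (e + C)) ^ 2 :=
        pow_le_pow_left₀ (by positivity) h3 2
    _ = (5 * (e : ℝ) * (2 : ℝ) ^ (e + C) / a) ^ 2 * (1 / ε) ^ (2 * (e + C)) := by
        rw [mul_pow, mul_comm 2, Real.rpow_mul (by positivity), Real.rpow_two]
    _ ≤ _ := by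
        have : 0 ≤ (1 / ε) ^ (2 * (e + C)) := by positivity
        linarith

end AsymApproxHom

theorem proposition1p4 {U W : Type*} [Fintype U] [Fintype W]
    (F : SimpleGraph U) (H : SimpleGraph W) :
    (Nonempty (H →g F) →
      ∀ δ : ℝ → ℝ,
        (∀ ε ∈ Set.Ioo (0 : ℝ) 1, δ ε ∈ Set.Ioo (0 : ℝ) 1) →
        (∀ ε ∈ Set.Ioo (0 : ℝ) 1,
          AsymApproxHom.FarImpliesManyCopies (fun G => AsymApproxHom.HomFree F G) H ε (δ ε)) →
        ∀ ε ∈ Set.Ioo (0 : ℝ) 2,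
          (AsymApproxHom.approxHomBounds F H ε).Nonempty ∧
          (AsymApproxHom.approxHomNumber F H ε : ℝ) ≤
            (2 : ℝ) ^ ((5 * (H.edgeSet.ncard : ℝ) * (2 / ε) ^ H.edgeSet.ncard / δ (ε / 2)) ^ 2)) ∧
    (∀ k : ℕ,
      Nonempty (H →g (⊤ : SimpleGraph (Fin k))) →
      AsymApproxHom.IsAbundant (⊤ : SimpleGraph (Fin k)) H →
      ∃ c C : ℝ, 0 < c ∧ 0 < C ∧ ∀ ε : ℝ, 0 < ε →
        (AsymApproxHom.approxHomBounds (⊤ : SimpleGraph (Fin k)) H ε).Nonempty ∧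
        (AsymApproxHom.approxHomNumber (⊤ : SimpleGraph (Fin k)) H ε : ℝ) ≤
          (2 : ℝ) ^ (c * (1 / ε) ^ C)) := by
  refine ⟨fun hHF δ hδ hfar ε hε => ?_, fun k hHk ⟨c, C, hc, hC, hab⟩ => ?_⟩
  · have hmem : ε / 2 ∈ Set.Ioo (0 : ℝ) 1 := ⟨by linarith [hε.1], by linarith [hε.2]⟩
    exact AsymApproxHom.approxHomNumber_le hHF hε.1 hε.2 (hδ _ hmem).1 (hδ _ hmem).2
      (hfar _ hmem)
  · -- Lowering `c` to `a` makes `a * ε ^ C` a function with values in `(0, 1)`.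
    set a : ℝ := min c (1 / 2)
    have ha : 0 < a := by positivity
    set e := H.edgeSet.ncard
    refine ⟨(5 * (e : ℝ) * (2 : ℝ) ^ (e + C) / a) ^ 2 + 1, 2 * (e + C), by positivity,
      by positivity, fun ε hε0 => ?_⟩
    rcases lt_or_ge ε 2 with hε2 | hε2
    · have hmem : ε / 2 ∈ Set.Ioo (0 : ℝ) 1 := ⟨by linarith, by linarith⟩
      have hpow : (ε / 2) ^ C ≤ 1 := Real.rpow_le_one hmem.1.le hmem.2.le hC.le
      have hpow0 : 0 < (ε / 2) ^ C := Real.rpow_pos_of_pos hmem.1 C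
      have hlt : a * (ε / 2) ^ C < 1 := by
        have : a ≤ 1 / 2 := min_le_right _ _
        nlinarith
      obtain ⟨hne, hle⟩ := AsymApproxHom.approxHomNumber_le hHk hε0 hε2
        (mul_pos ha hpow0) hlt
        ((hab _ hmem).mono (mul_le_mul_of_nonneg_right (min_le_left _ _) hpow0.le)
          fun _ _ h => AsymApproxHom.homFree_top_of_free h)
      exact ⟨hne, hle.trans (Real.rpow_le_rpow_of_exponent_le (by norm_num)
        (AsymApproxHom.sq_le_mul_rpow e hε0 ha le_rfl))⟩
    · obtain ⟨hne, hle⟩ := AsymApproxHom.approxHomNumber_le_one hHk hε2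
      exact ⟨hne, hle.trans (Real.one_le_rpow (by norm_num) (by positivity))⟩
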